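/- Fix a number $N\ge 2$ of players. A game $G=(A,u)$ consists of finite nonempty action sets $A_1,\dots,A_N$ and payoff functions $u_i\colon A=\prod_j A_j\to\mathbb R$. For a mixed strategy profile $p\in\prod_j\Delta A_j$, a player $i$ and an action $a_i\in A_i$, let $u_i(a_i,p_{-i})$ denote the lottery (finitely supported probability distribution on $\mathbb R$) of player $i$'s payoff when $i$ plays $a_i$ and the other players independently play according to $p_{-i}$. For a lottery $X$ and $a\in\mathbb R\setminus\{0\}$ put $K_a[X]=\frac1a\log\mathbb E[e^{aX}]$; moreover $K_0[X]=\mathbb E[X]$, and $K_{-\infty}[X]$ and $K_{+\infty}[X]$ are the minimum and the maximum of the support of $X$. Let $\mu$ be a Borel probability measure on $\overline{\mathbb R}=\mathbb R\cup\{-\infty,+\infty\}$, and let $\Phi[X]=\int_{\overline{\mathbb R}}K_a[X]\,\mathrm d\mu(a)$ be the corresponding monotone additive statistic. A profile $p$ is a $\mathrm{Nash}_\Phi$ equilibrium of $G$ if $\operatorname{supp}p_i\subseteq\operatorname{argmax}_{a_i\in A_i}\Phi[u_i(a_i,p_{-i})]$ for all $i$; for $\lambda\ge0$ it is an $\mathrm{LQRE}_{\lambda\Phi}$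 equilibrium if for all $i$ and $a_i\in A_i$ $$p_i(a_i)=\frac{\exp(\lambda\Phi[u_i(a_i,p_{-i})])}{\sum_{b\in A_i}\exp(\lambda\Phi[u_i(b,p_{-i})])}.$$ Then: 1. Every game has an $\mathrm{LQRE}_{\lambda\Phi}$ equilibrium for every $\lambda\ge0$. 2. Every game has a $\mathrm{Nash}_\Phi$ equilibrium if and only if $\mu(\{-\infty\})=\mu(\{+\infty\})=0$. 3. If $\varepsilon=\mu(\{-\infty\})+\mu(\{+\infty\})>0$, then the following game has no $\mathrm{Nash}_\Phi$ equilibrium: players $1$ and $2$ have action sets $\{a_1,b_1\}$ and $\{a_2,b_2\}$ and payoffs $(u_1,u_2)$ equal to $(1+\frac1\varepsilon,0)$ at $(a_1,a_2)$, $(0,1)$ at $(a_1,b_2)$, $(-\frac1\varepsilon,1)$ at $(b_1,a_2)$ and $(1,0)$ at $(b_1,b_2)$, and every other player has a single action and payoff $0$. -/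

import Mathlib

/-!
Brouwer's theorem on a simplex comes from a parity argument of Scarf type: over every finite set of
points it produces an almost completely labelled configuration, compactness turns these into the
Knaster–Kuratowski–Mazurkiewicz covering lemma, and the latter gives fixed points. A product of
simplices is a retract of a single simplex, so the logit response to utilities depending
continuously on the profile has a fixed point.

A logit response has full support. Along such profiles the support of every payoff lottery, hence
its minimum and maximum, is constant, so the atoms of `μ` at `±∞` contribute constants to
`Φ[u_i(a, p_{-i})]` and the rest is continuous by dominated convergence. This gives LQRE without any
restriction on `μ`. If `μ` has no atom at `±∞`, then `Φ` itself is continuous and limits of LQRE as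
`λ → ∞` are Nash equilibria.

In the modified matching pennies, as soon as the first column has positive probability, the first
row beats the second by at least `1/ε` in minimum and in maximum and loses at most `1` in `K_a` for
real `a`; weighting by `μ`, the first player then strictly prefers the first row, to which the
second player responds with the second column. If the first column is not played, the first player
strictly prefers the second row, to which the second player responds with the first column.
-/

universe u

noncomputable section

/-- A lottery: a finitely supported probability distribution on the real line. -/
structure Lottery where
  /-- the probability of each outcome -/
  prob : ℝ →₀ ℝ
  nonneg : ∀ x, 0 ≤ prob x
  total : ∑ x ∈ prob.support, prob x = 1

namespace Lottery

theorem support_nonempty (X : Lottery) : X.prob.support.Nonempty := by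
  by_contra h
  have := X.total
  rw [Finset.not_nonempty_iff_eq_empty.mp h] at this
  simp at this

/-- The expectation of `f (X)`. -/
def expect (X : Lottery) (f : ℝ → ℝ) : ℝ :=
  ∑ x ∈ X.prob.support, X.prob x * f x

/-- The normalized cumulant generating function `K_a[X] = (1/a) log E[exp(a X)]`, extended to
`a = 0` by the expectation, to `a = -∞` by the minimum of the support of `X` and to `a = +∞` by
its maximum. -/
def K (a : EReal) (X : Lottery) : ℝ :=
  match a with
  | ⊥ => X.prob.support.min' X.support_nonempty
  | ⊤ => X.prob.support.max' X.support_nonempty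
  | (a : ℝ) =>
      if a = 0 then X.expect (fun x => x)
      else 1 / a * Real.log (X.expect (fun x => Real.exp (a * x)))

/-- The statistic `Φ = ∫ K_a dμ(a)`. -/
def mixK (μ : MeasureTheory.Measure EReal) (X : Lottery) : ℝ :=
  ∫ a, K a X ∂μ

end Lottery

/-- A finite normal form game between `N` players. -/
structure Game (N : ℕ) where
  /-- the actions of each player -/
  A : Fin N → Type u
  [fintypeA : ∀ i, Fintype (A i)]
  [nonemptyA : ∀ i, Nonempty (A i)]
  /-- `payoff i a` is the payoff of player `i` at the action profile `a` -/
  payoff : Fin N → (∀ j, A j) → ℝ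

attribute [instance] Game.fintypeA Game.nonemptyA

namespace Game

variable {N : ℕ}

/-- A mixed strategy profile: a probability distribution on the actions of every player. -/
structure Profile (G : Game.{u} N) where
  /-- `prob i a` is the probability with which player `i` plays the action `a` -/
  prob : ∀ i, G.A i → ℝ
  mem_simplex : ∀ i, prob i ∈ stdSimplex ℝ (G.A i)

theorem Profile.sum_prod (G : Game.{u} N) (p : G.Profile) :
    ∑ b : (∀ j, G.A j), ∏ j, p.prob j (b j) = 1 := by
  rw [← Fintype.piFinset_univ, ← Finset.prod_univ_sum]
  exact Finset.prod_eq_one fun i _ => (p.mem_simplex i).2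

/-- The lottery `u_i(a_i, p_{-i})` faced by player `i` when playing `a` while the others play
according to `p`: a profile `b` is drawn from the product distribution of `p`, and the `i`-th
action in it is replaced by `a`. -/
def lottery (G : Game.{u} N) (p : G.Profile) (i : Fin N) (a : G.A i) : Lottery where
  prob := ∑ b : (∀ j, G.A j),
    Finsupp.single (G.payoff i (Function.update b i a)) (∏ j, p.prob j (b j))
  nonneg x := by
    rw [Finsupp.finsetSum_apply]
    refine Finset.sum_nonneg fun b _ => ?_
    rw [Finsupp.single_apply]
    split_ifs
    · exact Finset.prod_nonneg fun j _ => (p.mem_simplex j).1 (b j)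
    · exact le_rfl
  total := by
    change Finsupp.sum _ (fun _ w => w) = 1
    rw [← Finsupp.sum_finsetSum_index (fun _ => rfl) (fun _ _ _ => rfl)]
    simpa using p.sum_prod

/-- `p` is a `Nash_Φ` equilibrium: every action in the support of `p_i` maximizes
`Φ[u_i(·, p_{-i})]`. -/
def IsNash (Φ : Lottery → ℝ) (G : Game.{u} N) (p : G.Profile) : Prop :=
  ∀ (i : Fin N) (a : G.A i), p.prob i a ≠ 0 →
    ∀ b : G.A i, Φ (G.lottery p i b) ≤ Φ (G.lottery p i a)

/-- `p` is an `LQRE_{lam Φ}` equilibrium: `p_i(a)` is proportional to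
`exp (lam * Φ[u_i(a, p_{-i})])`. -/
def IsLQRE (Φ : Lottery → ℝ) (lam : ℝ) (G : Game.{u} N) (p : G.Profile) : Prop :=
  ∀ (i : Fin N) (a : G.A i),
    p.prob i a = Real.exp (lam * Φ (G.lottery p i a)) /
      ∑ b : G.A i, Real.exp (lam * Φ (G.lottery p i b))

/-- The variant of matching pennies with payoffs
```
        0               1
  0   (1 + 1/ε, 0)    (0, 1)
  1   (-1/ε, 1)       (1, 0)
```
between the first two of `N ≥ 2` players; all further players have a single action and
payoff `0`. -/
def modifiedPennies (N : ℕ) (hN : 2 ≤ N) (ε : ℝ) : Game.{u} N where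
  A i := ULift (Fin (if (i : ℕ) < 2 then 2 else 1))
  nonemptyA i := ⟨⟨⟨0, by split_ifs <;> norm_num⟩⟩⟩
  payoff i a :=
    let x : ℕ := (a ⟨0, by omega⟩).down
    let y : ℕ := (a ⟨1, by omega⟩).down
    if (i : ℕ) = 0 then
      if x = 0 then (if y = 0 then 1 + 1 / ε else 0) else (if y = 0 then -(1 / ε) else 1)
    else if (i : ℕ) = 1 then (if x = y then 0 else 1)
    else 0

end Game

end

section Scarf

open Finset

theorem card_filter_image_erase_eq_two {α β : Type*} [DecidableEq α] [DecidableEq β]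
    {s : Finset α} {f : α → β} (h : #(s.image f) + 1 = #s) :
    #{x ∈ s | (s.erase x).image f = s.image f} = 2 := by
  have injOn_erase {w} (hw : w ∈ s) (himage : (s.erase w).image f = s.image f) :
      Set.InjOn f (s.erase w) := by
    apply injOn_of_card_image_eq
    rw [himage, card_erase_of_mem hw]
    lia
  have image_erase {x z} (hz : z ∈ s) (hzx : z ≠ x) (hfzx : f z = f x) :
      (s.erase x).image f = s.image f := by
    grind
  obtain ⟨x, hx, z, hz, hxz, hfxz⟩ : ∃ x ∈ s, ∃ z ∈ s, x ≠ z ∧ f x = f z :=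
    exists_ne_map_eq_of_card_lt_of_maps_to (by lia) fun _ => mem_image_of_mem f
  refine card_eq_two.2 ⟨x, z, hxz, ext fun w => ⟨fun hw => ?_, fun hw => ?_⟩⟩
  · obtain ⟨hws, himage⟩ := mem_filter.1 hw
    by_contra! hne
    have hinj := injOn_erase hws himage
    exact hxz (hinj (by grind) (by grind) hfxz)
  · grind

theorem sum_card_erase_mem_eq_sum_card_insert_mem {α : Type*} [Fintype α] [DecidableEq α]
    (𝒜 ℬ : Finset (Finset α)) :
    ∑ s ∈ 𝒜, #{x ∈ s | s.erase x ∈ ℬ} = ∑ t ∈ ℬ, #{x ∈ tᶜ | insert x t ∈ 𝒜} := by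
  simp only [← card_sigma]
  refine card_nbij' (fun q => ⟨q.1.erase q.2, q.2⟩) (fun q => ⟨insert q.2 q.1, q.2⟩) ?_ ?_ ?_ ?_
  · rintro ⟨s, x⟩ h
    simp_all
  · rintro ⟨t, x⟩ h
    simp_all
  · rintro ⟨s, x⟩ h
    simp_all
  · rintro ⟨t, x⟩ h
    simp_all

theorem even_card_filter_image_erase_eq {α β : Type*} [DecidableEq α] [Fintype β] [DecidableEq β]
    {s : Finset α} {f : α → β} (hcard : #s = Fintype.card β) (hf : s.image f ≠ univ) (b : β) :
    Even #{x ∈ s | (s.erase x).image f = univ.erase b} := by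
  by_cases himage : s.image f = univ.erase b
  · rw [← himage, card_filter_image_erase_eq_two]
    · exact even_two
    · rw [himage, card_erase_add_one (mem_univ b), card_univ, hcard]
  · rw [filter_false_of_mem fun x hx hxb => ?_, card_empty]
    · exact Even.zero
    · have hinsert : s.image f = insert (f x) (univ.erase b) := by
        rw [← hxb, ← image_insert, insert_erase hx]
      by_cases hfx : f x = b
      · exact hf (by rw [hinsert, hfx, insert_erase (mem_univ b)])
      · exact himage (by rw [hinsert, insert_eq_of_mem (by simp [hfx])])

variable {V I R : Type*}

variable [LinearOrder R]

/-- A finite set `σ` is dominant for the family of rankings `r` if every element lies weakly below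
all of `σ` in at least one of the rankings. -/
def IsDominantSet (r : I → V → R) (σ : Finset V) : Prop :=
  ∀ y, ∃ i, ∀ x ∈ σ, r i y ≤ r i x

/-- The elements that can lie weakly below all of `τ` only in the ranking `k`. A dominant set `τ`
is enlarged to a dominant set by adding a highest such element in the ranking `k`. -/
def exclusiveRegion (r : I → V → R) (τ : Finset V) (k : I) : Set V :=
  {y | ∀ l, (∀ x ∈ τ, r l y ≤ r l x) → l = k}

namespace IsDominantSet

variable {r : I → V → R} {σ τ : Finset V}

theorem mono (h : IsDominantSet r σ) (hτ : τ ⊆ σ) : IsDominantSet r τ := fun y =>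
  (h y).imp fun _ hi x hx => hi x (hτ hx)

theorem forall_le_of_mem_exclusiveRegion (hτ : IsDominantSet r τ) {k : I} {y : V}
    (hy : y ∈ exclusiveRegion r τ k) : ∀ x ∈ τ, r k y ≤ r k x := by
  obtain ⟨l, hl⟩ := hτ y
  exact hy l hl ▸ hl

theorem eq_of_mem_exclusiveRegion (hτ : IsDominantSet r τ) {k l : I} {y : V}
    (hk : y ∈ exclusiveRegion r τ k) (hl : y ∈ exclusiveRegion r τ l) : k = l :=
  hl k (hτ.forall_le_of_mem_exclusiveRegion hk)

theorem existsUnique_forall_le [Fintype I] (hr : ∀ i, Function.Injective (r i))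
    (hσ : IsDominantSet r σ) (hcard : #σ = Fintype.card I) {x : V} (hx : x ∈ σ) :
    ∃! k, ∀ z ∈ σ, r k x ≤ r k z := by
  classical
  choose low hlow_mem hlow using fun i => σ.exists_min_image (r i) ⟨x, hx⟩
  have low_eq {i y} (hy : y ∈ σ) (hle : ∀ z ∈ σ, r i y ≤ r i z) : low i = y :=
    hr i ((hlow i y hy).antisymm (hle _ (hlow_mem i)))
  have himage : univ.image low = σ := by
    refine Subset.antisymm (by simpa [image_subset_iff] using hlow_mem) fun y hy => ?_
    obtain ⟨i, hi⟩ := hσ y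
    exact mem_image.2 ⟨i, mem_univ i, low_eq hy hi⟩
  have hinj : Set.InjOn low (univ : Finset I) := by
    apply injOn_of_card_image_eq
    rw [himage, hcard, card_univ]
  obtain ⟨k, hk⟩ := hσ x
  exact ⟨k, hk, fun l hl =>
    hinj (by simp) (by simp) ((low_eq hx hl).trans (low_eq hx hk).symm)⟩

variable [DecidableEq V]

theorem insert_of_isGreatest (hτ : IsDominantSet r τ) {k : I} {x : V}
    (hx : x ∈ exclusiveRegion r τ k) (hmax : ∀ y ∈ exclusiveRegion r τ k, r k y ≤ r k x) :
    IsDominantSet r (insert x τ) := by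
  intro z
  simp only [forall_mem_insert]
  by_cases hz : z ∈ exclusiveRegion r τ k
  · exact ⟨k, hmax z hz, hτ.forall_le_of_mem_exclusiveRegion hz⟩
  · obtain ⟨l, hl, hlk⟩ : ∃ l, (∀ w ∈ τ, r l z ≤ r l w) ∧ l ≠ k := by
      simpa [exclusiveRegion] using hz
    obtain ⟨w, hw, hwx⟩ : ∃ w ∈ τ, r l w < r l x := by
      by_contra! hle
      exact hlk (hx l hle)
    exact ⟨l, (hl w hw).trans hwx.le, hl⟩

variable [Fintype I]

theorem exists_isGreatest_of_insert (hr : ∀ i, Function.Injective (r i))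
    (hcard : #τ + 1 = Fintype.card I) {x : V} (hx : x ∉ τ) (h : IsDominantSet r (insert x τ)) :
    ∃ k, (∀ w ∈ τ, w ∉ exclusiveRegion r τ k) ∧ x ∈ exclusiveRegion r τ k ∧
      ∀ y ∈ exclusiveRegion r τ k, r k y ≤ r k x := by
  obtain ⟨k, hk, hk_unique⟩ := h.existsUnique_forall_le hr
    (by rw [card_insert_of_notMem hx, hcard]) (mem_insert_self x τ)
  simp only [forall_mem_insert, le_refl, true_and] at hk hk_unique
  refine ⟨k, fun w hw hw_region => hx ?_, hk_unique, fun y hy => ?_⟩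
  · obtain ⟨l, hl⟩ := h w
    rw [forall_mem_insert] at hl
    obtain rfl : l = k := hw_region l hl.2
    exact hr l ((hk w hw).antisymm hl.1) ▸ hw
  · obtain ⟨l, hl⟩ := h y
    rw [forall_mem_insert] at hl
    exact hy l hl.2 ▸ hl.1

variable {v : I → V}

theorem image_erase (hv₀ : ∀ i x, r i (v i) ≤ r i x)
    (hv : ∀ i j x, j ≠ i → x ∉ Set.range v → r i x < r i (v j)) [DecidableEq I] (i₀ : I) :
    IsDominantSet r ((univ.erase i₀).image v) := by
  intro y
  by_cases hy : y ∈ Set.range v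
  · obtain ⟨a, rfl⟩ := hy
    exact ⟨a, fun x _ => hv₀ a x⟩
  · exact ⟨i₀, by simpa using fun j hj => (hv i₀ j y hj hy).le⟩

variable [Fintype V] [DecidablePred (IsDominantSet r)]

open Classical in
theorem card_filter_insert (hr : ∀ i, Function.Injective (r i))
    (hτ : IsDominantSet r τ) (hcard : #τ + 1 = Fintype.card I) :
    #{x ∈ τᶜ | IsDominantSet r (insert x τ)} =
      #{k | (∀ w ∈ τ, w ∉ exclusiveRegion r τ k) ∧ (exclusiveRegion r τ k).Nonempty} := by
  have exists_top k (hk : (exclusiveRegion r τ k).Nonempty) :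
      ∃ y ∈ exclusiveRegion r τ k, ∀ z ∈ exclusiveRegion r τ k, r k z ≤ r k y :=
    Set.exists_max_image _ (r k) (Set.toFinite _) hk
  choose top htop htop_max using exists_top
  symm
  refine card_bij (fun k hk => top k (mem_filter.1 hk).2.2) (fun k hk => ?_)
    (fun k hk l hl htop_eq => ?_) fun x hx => ?_
  · obtain ⟨-, hdisj, hne⟩ := mem_filter.1 hk
    have hnotMem : top k hne ∉ τ := fun hmem => hdisj _ hmem (htop k hne)
    simpa [hnotMem] using hτ.insert_of_isGreatest (htop k hne) (htop_max k hne)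
  · have hk_mem := htop k (mem_filter.1 hk).2.2
    have hl_mem := htop l (mem_filter.1 hl).2.2
    exact hτ.eq_of_mem_exclusiveRegion hk_mem (htop_eq ▸ hl_mem)
  · obtain ⟨hxτ, hdom⟩ : x ∉ τ ∧ IsDominantSet r (insert x τ) := by simpa using hx
    obtain ⟨k, hdisj, hxk, hmax⟩ := exists_isGreatest_of_insert hr hcard hxτ hdom
    have hne : (exclusiveRegion r τ k).Nonempty := ⟨x, hxk⟩
    refine ⟨k, by simpa using ⟨hdisj, hne⟩, hr k ?_⟩
    exact (hmax _ (htop k hne)).antisymm (htop_max k hne x hxk)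

theorem card_filter_insert_eq_two (hr : ∀ i, Function.Injective (r i))
    (hv : ∀ i j x, j ≠ i → x ∉ Set.range v → r i x < r i (v j)) (hτ : IsDominantSet r τ)
    (hcard : #τ + 1 = Fintype.card I) {t : V} (ht : t ∈ τ) (htv : t ∉ Set.range v) :
    #{x ∈ τᶜ | IsDominantSet r (insert x τ)} = 2 := by
  classical
  choose low hlow_mem hlow using fun i => τ.exists_min_image (r i) ⟨t, ht⟩
  have low_eq_iff {i w} (hw : w ∈ τ) : low i = w ↔ ∀ x ∈ τ, r i w ≤ r i x :=
    ⟨fun h => h ▸ hlow i, fun h => hr i ((hlow i w hw).antisymm (h _ (hlow_mem i)))⟩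
  have himage : univ.image low = τ := by
    refine Subset.antisymm (by simpa [image_subset_iff] using hlow_mem) fun w hw => ?_
    obtain ⟨i, hi⟩ := hτ w
    exact mem_image.2 ⟨i, mem_univ i, (low_eq_iff hw).2 hi⟩
  have region_nonempty k : (exclusiveRegion r τ k).Nonempty := by
    refine ⟨v k, fun l hl => ?_⟩
    by_contra! hlk
    exact (hv l k t hlk.symm htv).not_ge (hl t ht)
  have disjoint_iff k :
      (∀ w ∈ τ, w ∉ exclusiveRegion r τ k) ↔ (univ.erase k).image low = univ.image low := by
    have mem_region_iff {w} (hw : w ∈ τ) :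
        w ∉ exclusiveRegion r τ k ↔ w ∈ (univ.erase k).image low := by
      simp [exclusiveRegion, ← low_eq_iff hw, and_comm]
    rw [subset_antisymm_iff, and_iff_right (image_subset_image (subset_univ _)), himage]
    exact forall₂_congr fun w hw => mem_region_iff hw
  rw [card_filter_insert hr hτ hcard]
  simp only [region_nonempty, and_true, disjoint_iff]
  exact card_filter_image_erase_eq_two (by rw [himage, hcard, card_univ])

theorem card_filter_insert_image_erase (hr : ∀ i, Function.Injective (r i))
    (hv_inj : Function.Injective v) (hv₀ : ∀ i x, r i (v i) ≤ r i x)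
    (hv : ∀ i j x, j ≠ i → x ∉ Set.range v → r i x < r i (v j)) [DecidableEq I] (i₀ : I) :
    #{x ∈ ((univ.erase i₀).image v)ᶜ | IsDominantSet r (insert x ((univ.erase i₀).image v))} =
      1 := by
  have hcard : #((univ.erase i₀).image v) + 1 = Fintype.card I := by
    rw [card_image_of_injective _ hv_inj, card_erase_add_one (mem_univ i₀), card_univ]
  rw [card_filter_insert hr (image_erase hv₀ hv i₀) hcard, card_eq_one]
  refine ⟨i₀, ext fun k => ?_⟩
  simp only [mem_filter_univ, mem_singleton]
  constructor
  · rintro ⟨hdisj, y, hy⟩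
    by_contra! hk
    by_cases hyv : y ∈ Set.range v
    · obtain ⟨a, rfl⟩ := hyv
      obtain rfl : a = k := hy a fun x _ => hv₀ a x
      exact hdisj (v a) (mem_image_of_mem v (by simpa using hk)) hy
    · exact hk (hy i₀ (by simpa using fun j hj => (hv i₀ j y hj hyv).le)).symm
  · rintro rfl
    refine ⟨fun w hw hw_region => ?_, v k, fun l hl => ?_⟩
    · obtain ⟨j, hj, rfl⟩ : ∃ j, j ≠ k ∧ v j = w := by simpa using hw
      exact hj (hw_region j fun x _ => hv₀ j x)
    · by_contra! hlk
      have hle : r l (v k) ≤ r l (v l) := hl _ (mem_image_of_mem v (by simpa using hlk))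
      exact hlk (hv_inj (hr l ((hv₀ l _).antisymm hle)))

end IsDominantSet

theorem exists_mem_notMem_range_of_image_eq_erase [Fintype I] [DecidableEq V] [DecidableEq I]
    {v : I → V} {c : V → I} (hc : ∀ i, c (v i) = i) {τ : Finset V} {i₀ : I}
    (himage : τ.image c = univ.erase i₀) (hcard : #τ + 1 = Fintype.card I)
    (hne : τ ≠ (univ.erase i₀).image v) : ∃ t ∈ τ, t ∉ Set.range v := by
  by_contra! hslack
  refine hne (eq_of_subset_of_card_le (fun x hx => ?_) ?_)
  · obtain ⟨j, rfl⟩ := hslack x hx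
    rw [← himage]
    exact mem_image_of_mem v (mem_image.2 ⟨v j, hx, hc j⟩)
  · have := card_image_le (s := univ.erase i₀) (f := v)
    have := card_erase_add_one (mem_univ i₀)
    rw [card_univ] at this
    lia

-- Count the pairs of a room and a door inside it: a room that is not fully coloured has an even
-- number of doors, while `τ₀` lies in one room and every other door in two.
theorem exists_isDominantSet_image_eq_univ [Finite V] [Fintype I] [Nonempty I] [DecidableEq I]
    {r : I → V → R} {v : I → V} (hr : ∀ i, Function.Injective (r i))
    (hv₀ : ∀ i x, r i (v i) ≤ r i x)
    (hv : ∀ i j x, j ≠ i → x ∉ Set.range v → r i x < r i (v j))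
    {c : V → I} (hc : ∀ i, c (v i) = i) :
    ∃ σ, IsDominantSet r σ ∧ σ.image c = univ := by
  classical
  have := Fintype.ofFinite V
  by_contra! hnone
  obtain ⟨i₀⟩ := ‹Nonempty I›
  have hv_inj : Function.Injective v := Function.LeftInverse.injective hc
  let rooms : Finset (Finset V) := {σ | #σ = Fintype.card I ∧ IsDominantSet r σ}
  let doors : Finset (Finset V) :=
    {τ | #τ + 1 = Fintype.card I ∧ IsDominantSet r τ ∧ τ.image c = univ.erase i₀}
  let τ₀ : Finset V := (univ.erase i₀).image v
  have hτ₀_card : #τ₀ + 1 = Fintype.card I := by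
    rw [card_image_of_injective _ hv_inj, card_erase_add_one (mem_univ i₀), card_univ]
  have hτ₀ : τ₀ ∈ doors := by
    refine mem_filter.2 ⟨mem_univ _, hτ₀_card, .image_erase hv₀ hv i₀, ?_⟩
    rw [image_image, show c ∘ v = id from funext hc, image_id]
  have hrooms : Even (∑ σ ∈ rooms, #{x ∈ σ | σ.erase x ∈ doors}) := by
    refine even_sum _ fun σ hσ => ?_
    obtain ⟨-, hcard, hdom⟩ := mem_filter.1 hσ
    rw [filter_congr (q := fun x => (σ.erase x).image c = univ.erase i₀) fun x hx => ?_]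
    · exact even_card_filter_image_erase_eq hcard (hnone σ hdom) i₀
    · simp [doors, card_erase_add_one hx, hcard, hdom.mono (erase_subset x σ)]
  have insert_mem_rooms {τ : Finset V} (hτ : #τ + 1 = Fintype.card I) :
      #{x ∈ τᶜ | insert x τ ∈ rooms} = #{x ∈ τᶜ | IsDominantSet r (insert x τ)} := by
    congr 1
    refine filter_congr fun x hx => ?_
    simp [rooms, card_insert_of_notMem (mem_compl.1 hx), hτ]
  have hdoors : Even (∑ τ ∈ doors.erase τ₀, #{x ∈ τᶜ | insert x τ ∈ rooms}) := by
    refine even_sum _ fun τ hτ => ?_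
    obtain ⟨hne, hτ⟩ := mem_erase.1 hτ
    obtain ⟨-, hcard, hdom, himage⟩ := mem_filter.1 hτ
    obtain ⟨t, ht, htv⟩ := exists_mem_notMem_range_of_image_eq_erase hc himage hcard hne
    rw [insert_mem_rooms hcard, hdom.card_filter_insert_eq_two hr hv hcard ht htv]
    exact even_two
  rw [sum_card_erase_mem_eq_sum_card_insert_mem, ← add_sum_erase _ _ hτ₀,
    insert_mem_rooms hτ₀_card, IsDominantSet.card_filter_insert_image_erase hr hv_inj hv₀ hv,
    Nat.even_add] at hrooms
  exact Nat.not_even_one (hrooms.2 hdoors)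

variable {T : Type*} [Finite T] [Finite I] [DecidableEq I]

/-- The rankings `h` of `T` extended by one slack element per ranking: the slack element of `i` is
the lowest in the ranking `i` and lies above `T` in all others. Ties are broken lexicographically
by an enumeration. -/
noncomputable def slackRanking (h : I → T → R) (i : I) (x : T ⊕ I) :
    WithBot (WithTop R) ×ₗ Fin (Nat.card (T ⊕ I)) :=
  toLex (Sum.elim (fun t => ((h i t : WithTop R) : WithBot (WithTop R)))
    (fun j => if j = i then ⊥ else ⊤) x, Finite.equivFin (T ⊕ I) x)

variable (h : I → T → R)

theorem le_of_slackRanking_le {i : I} {s t : T}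
    (hst : slackRanking h i (.inl s) ≤ slackRanking h i (.inl t)) : h i s ≤ h i t := by
  simpa [slackRanking] using Prod.Lex.monotone_fst _ _ hst

theorem slackRanking_inr_lt_inl (i : I) (t : T) :
    slackRanking h i (.inr i) < slackRanking h i (.inl t) :=
  Prod.Lex.toLex_lt_toLex.2 (.inl (by simp))

theorem slackRanking_inl_lt_inr {i j : I} (hji : j ≠ i) (t : T) :
    slackRanking h i (.inl t) < slackRanking h i (.inr j) :=
  Prod.Lex.toLex_lt_toLex.2 <| .inl <| by
    simpa [hji] using WithBot.coe_lt_coe.2 (WithTop.coe_lt_top (h i t))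

theorem slackRanking_inr_le (i : I) (x : T ⊕ I) :
    slackRanking h i (.inr i) ≤ slackRanking h i x := by
  obtain t | j := x
  · exact (slackRanking_inr_lt_inl h i t).le
  · obtain rfl | hji := eq_or_ne j i
    · exact le_rfl
    · exact (Prod.Lex.toLex_lt_toLex.2 (.inl (by simp [hji]))).le

theorem exists_finset_forall_exists_mem_image_forall_le (c : T → I) :
    ∃ σ : Finset T, ∀ y, ∃ i ∈ σ.image c, ∀ x ∈ σ, h i y ≤ h i x := by
  cases isEmpty_or_nonempty I with
  | inl _ => exact ⟨∅, fun y => isEmptyElim (c y)⟩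
  | inr _ =>
    have := Fintype.ofFinite I
    have hinj (i : I) : Function.Injective (slackRanking h i) := fun _ _ hxy =>
      (Finite.equivFin (T ⊕ I)).injective (congrArg (fun p => (ofLex p).2) hxy)
    obtain ⟨σ, hdom, himage⟩ :=
      exists_isDominantSet_image_eq_univ (v := Sum.inr) (c := Sum.elim c id) hinj
        (slackRanking_inr_le h)
        (fun i j x hji hx => by
          obtain t | k := x
          · exact slackRanking_inl_lt_inr h hji t
          · simp at hx) fun i => rfl
    refine ⟨σ.toLeft, fun y => ?_⟩
    obtain ⟨i, hi⟩ := hdom (.inl y)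
    obtain ⟨t | j, hmem, hcolour⟩ := mem_image.1 (himage.ge (mem_univ i))
    · exact ⟨i, mem_image.2 ⟨t, by simpa using hmem, hcolour⟩, fun x hx =>
        le_of_slackRanking_le h (hi _ (mem_toLeft.1 hx))⟩
    · obtain rfl : j = i := hcolour
      exact absurd (hi _ hmem) (slackRanking_inr_lt_inl h j y).not_ge

end Scarf

section KKM

variable {ι : Type*} [Fintype ι]

theorem continuous_stdSimplex_apply (i : ι) : Continuous fun x : stdSimplex ℝ ι => x i :=
  (continuous_apply i).comp continuous_subtype_val

theorem exists_stdSimplex_forall_le_of_sum_le_one [Nonempty ι] {b : ι → ℝ} (hb : ∀ i, 0 ≤ b i)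
    (hsum : ∑ i, b i ≤ 1) : ∃ z : stdSimplex ℝ ι, ∀ i, b i ≤ z i := by
  classical
  obtain ⟨i₀⟩ := ‹Nonempty ι›
  have hsingle : 0 ≤ (Pi.single i₀ (1 - ∑ j, b j) : ι → ℝ) :=
    Pi.single_nonneg.2 (sub_nonneg.2 hsum)
  refine ⟨⟨b + Pi.single i₀ (1 - ∑ j, b j), fun i => add_nonneg (hb i) (hsingle i), ?_⟩,
    fun i => le_add_of_nonneg_right (hsingle i)⟩
  simp [Finset.sum_add_distrib]

theorem one_lt_sum_add_of_forall_exists_le [Nonempty ι] {T : Set (stdSimplex ℝ ι)} {η : ℝ}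
    (hT : Set.univ ⊆ ⋃ y ∈ T, Metric.ball y η) {a : ι → ℝ} (ha : ∀ i, 0 ≤ a i + η)
    (hle : ∀ y ∈ T, ∃ i, y i ≤ a i) : 1 < ∑ i, (a i + η) := by
  by_contra! hsum
  obtain ⟨z, hz⟩ := exists_stdSimplex_forall_le_of_sum_le_one ha hsum
  obtain ⟨y, hy, hzy⟩ : ∃ y ∈ T, dist z y < η := by simpa using hT (Set.mem_univ z)
  obtain ⟨i, hi⟩ := hle y hy
  have hdist : dist (z i) (y i) < η := (dist_le_pi_dist z.1 y.1 i).trans_lt hzy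
  linarith [hz i, Real.sub_le_dist (z i) (y i)]

theorem exists_finset_forall_le_and_one_lt_sum [Nonempty ι] (c : stdSimplex ℝ ι → ι) {η : ℝ}
    (hη : 0 < η) : ∃ (σ : Finset (stdSimplex ℝ ι)) (a : ι → ℝ), σ.Nonempty ∧
      (∀ i, a i = 0 ∨ ∃ y ∈ σ, c y = i) ∧ (∀ x ∈ σ, ∀ i, a i ≤ x i) ∧ 1 < ∑ i, (a i + η) := by
  classical
  obtain ⟨T, -, hT_fin, hT⟩ :=
    finite_cover_balls_of_compact (X := stdSimplex ℝ ι) isCompact_univ hη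
  have : Finite T := hT_fin
  obtain ⟨σ', hσ'⟩ :=
    exists_finset_forall_exists_mem_image_forall_le (fun i (x : T) => x.1 i) (fun x => c x)
  let σ : Finset (stdSimplex ℝ ι) := σ'.map (Function.Embedding.subtype _)
  have hσ : ∀ y ∈ T, ∃ i ∈ σ.image c, ∀ x ∈ σ, y i ≤ x i := fun y hy => by
    simpa [σ] using hσ' ⟨y, hy⟩
  have hσ_ne : σ.Nonempty := by
    obtain ⟨y, hy, -⟩ := Set.mem_iUnion₂.1 (hT (Set.mem_univ (Classical.arbitrary _)))
    obtain ⟨i, hi, -⟩ := hσ y hy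
    exact Finset.image_nonempty.1 ⟨i, hi⟩
  let a (i : ι) : ℝ := if i ∈ σ.image c then σ.inf' hσ_ne fun x => x i else 0
  have ha i : 0 ≤ a i := by
    unfold a
    split_ifs
    · exact Finset.le_inf' _ _ fun x _ => stdSimplex.zero_le x i
    · exact le_rfl
  refine ⟨σ, a, hσ_ne, fun i => ?_, fun x hx i => ?_, ?_⟩
  · by_cases hi : i ∈ σ.image c
    · exact .inr (Finset.mem_image.1 hi)
    · exact .inl (if_neg hi)
  · unfold a
    split_ifs
    · exact Finset.inf'_le _ hx
    · exact stdSimplex.zero_le x i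
  · refine one_lt_sum_add_of_forall_exists_le hT (fun i => by have := ha i; positivity)
      fun y hy => ?_
    obtain ⟨i, hi, hi_le⟩ := hσ y hy
    exact ⟨i, by simpa only [a, if_pos hi] using Finset.le_inf' _ _ hi_le⟩

theorem exists_forall_le_or_exists_dist_le [Nonempty ι] (c : stdSimplex ℝ ι → ι) {ε : ℝ}
    (hε : 0 < ε) : ∃ x : stdSimplex ℝ ι, ∀ i, x i ≤ ε ∨ ∃ y, c y = i ∧ dist x y ≤ ε := by
  have hcard : (0 : ℝ) < Fintype.card ι := by exact_mod_cast Fintype.card_pos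
  obtain ⟨σ, a, ⟨x, hx⟩, ha, a_le, hsum⟩ :=
    exists_finset_forall_le_and_one_lt_sum c (div_pos hε hcard)
  have lt_a_add {z} (hz : z ∈ σ) i : z i < a i + ε := by
    have hle := Finset.single_le_sum (f := fun j => z j - a j)
      (fun j _ => sub_nonneg.2 (a_le z hz j)) (Finset.mem_univ i)
    simp only [Finset.sum_sub_distrib, stdSimplex.sum_eq_one] at hle
    simp only [Finset.sum_add_distrib, Finset.sum_const, Finset.card_univ, nsmul_eq_mul,
      mul_div_cancel₀ _ hcard.ne'] at hsum
    linarith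
  refine ⟨x, fun i => (ha i).imp (fun hi => ?_) ?_⟩
  · simpa only [hi, zero_add] using (lt_a_add hx i).le
  · rintro ⟨y, hy, rfl⟩
    refine ⟨y, rfl, (dist_pi_le_iff hε.le).2 fun j => abs_sub_le_iff.2 ⟨?_, ?_⟩⟩
    · exact (sub_lt_iff_lt_add'.2 ((lt_a_add hx j).trans_le (by gcongr; exact a_le y hy j))).le
    · exact (sub_lt_iff_lt_add'.2 ((lt_a_add hy j).trans_le (by gcongr; exact a_le x hx j))).le

theorem nonempty_iInter_of_forall_eq_zero_mem [Nonempty ι] {C : ι → Set (stdSimplex ℝ ι)}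
    (hclosed : ∀ i, IsClosed (C i)) (hcover : ∀ x, ∃ i, x ∈ C i)
    (hface : ∀ i x, x i = 0 → x ∈ C i) : (⋂ i, C i).Nonempty := by
  choose c hc using hcover
  let F (n : ℕ) : Set (stdSimplex ℝ ι) :=
    ⋂ i, {x | x i ≤ 1 / (n + 1)} ∪ Metric.cthickening (1 / (n + 1)) (C i)
  have F_closed n : IsClosed (F n) := isClosed_iInter fun i =>
    (isClosed_le (continuous_stdSimplex_apply i) continuous_const).union Metric.isClosed_cthickening
  have F_anti n : F (n + 1) ⊆ F n := by
    have hle : 1 / ((n + 1 : ℕ) + 1 : ℝ) ≤ 1 / (n + 1) := Nat.one_div_le_one_div n.le_succ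
    exact Set.iInter_mono fun i => Set.union_subset_union (fun x hx => le_trans hx hle)
      (Metric.cthickening_mono hle _)
  have F_nonempty n : (F n).Nonempty := by
    obtain ⟨x, hx⟩ := exists_forall_le_or_exists_dist_le c (Nat.one_div_pos_of_nat (n := n))
    refine ⟨x, Set.mem_iInter.2 fun i => (hx i).imp_right ?_⟩
    rintro ⟨y, rfl, hxy⟩
    exact Metric.mem_cthickening_of_dist_le x y _ _ (hc y) hxy
  obtain ⟨x, hx⟩ := IsCompact.nonempty_iInter_of_sequence_nonempty_isCompact_isClosed F F_anti
    F_nonempty (F_closed 0).isCompact F_closed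
  refine ⟨x, Set.mem_iInter.2 fun i => ?_⟩
  obtain hzero | hpos := (stdSimplex.zero_le x i).eq_or_lt
  · exact hface i x hzero.symm
  have hlim := tendsto_one_div_add_atTop_nhds_zero_nat (𝕜 := ℝ)
  rw [← (hclosed i).closure_eq, Metric.mem_closure_iff_infEDist_zero, ← nonpos_iff_eq_zero]
  rw [← ENNReal.ofReal_zero]
  refine ge_of_tendsto (ENNReal.tendsto_ofReal hlim) ?_
  filter_upwards [hlim.eventually_lt_const hpos] with n hn
  exact (Set.mem_iInter.1 (Set.mem_iInter.1 hx n) i).resolve_left hn.not_ge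

end KKM

section Brouwer

variable {ι : Type*} [Fintype ι]

theorem exists_stdSimplex_eq_of_continuous [Nonempty ι] {f : stdSimplex ℝ ι → stdSimplex ℝ ι}
    (hf : Continuous f) : ∃ x, f x = x := by
  have hsum (x : stdSimplex ℝ ι) : ∑ i, x i = ∑ i, f x i :=
    (stdSimplex.sum_eq_one x).trans (stdSimplex.sum_eq_one (f x)).symm
  have hcover (x : stdSimplex ℝ ι) : ∃ i, x i ≤ f x i := by
    simpa using Finset.exists_le_of_sum_le Finset.univ_nonempty (hsum x).le
  obtain ⟨x, hx⟩ := nonempty_iInter_of_forall_eq_zero_mem (C := fun i => {x | x i ≤ f x i})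
    (fun i => isClosed_le (continuous_stdSimplex_apply i)
      ((continuous_stdSimplex_apply i).comp hf))
    hcover fun i x hx => hx.trans_le (stdSimplex.zero_le (f x) i)
  have hle : ∀ i, x i ≤ f x i := Set.mem_iInter.1 hx
  refine ⟨x, stdSimplex.ext (funext fun i => Eq.symm ?_)⟩
  exact (Finset.sum_eq_sum_iff_of_le fun i _ => hle i).1 (hsum x) i (Finset.mem_univ i)

end Brouwer

section ProductFixedPoint

variable {ι : Type*} [Fintype ι] [Nonempty ι]

/-- A continuous retraction of `ℝ^ι` onto the standard simplex: take positive parts, raise all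
coordinates equally if the sum `S` is below one, and normalise. -/
noncomputable def simplexRetraction (v : ι → ℝ) : stdSimplex ℝ ι :=
  let S : ℝ := ∑ b, max (v b) 0
  ⟨fun a => (max (v a) 0 + (max 1 S - S) / Fintype.card ι) / max 1 S, by
    have hS : S ≤ max 1 S := le_max_right _ _
    have hmax : 0 < max 1 S := by positivity
    refine ⟨fun a => div_nonneg (add_nonneg (le_max_right _ _) ?_) hmax.le, ?_⟩
    · exact div_nonneg (sub_nonneg.2 hS) (Nat.cast_nonneg _)
    · rw [← Finset.sum_div, div_eq_one_iff_eq hmax.ne', Finset.sum_add_distrib, Finset.sum_const,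
        Finset.card_univ, nsmul_eq_mul, mul_div_cancel₀ _ (by positivity)]
      exact add_sub_cancel S _⟩

theorem continuous_simplexRetraction :
    Continuous (simplexRetraction : (ι → ℝ) → stdSimplex ℝ ι) := by
  refine Continuous.subtype_mk (continuous_pi fun a => Continuous.div ?_ ?_ fun v => ?_) _
  · fun_prop
  · fun_prop
  · positivity

theorem simplexRetraction_apply_self (x : stdSimplex ℝ ι) : simplexRetraction x = x := by
  refine stdSimplex.ext (funext fun a => ?_)
  have hmax b : max (x b) 0 = x b := max_eq_left (stdSimplex.zero_le x b)
  change (max (x a) 0 + (max 1 (∑ b, max (x b) 0) - ∑ b, max (x b) 0) / _) / _ = x a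
  simp only [hmax, stdSimplex.sum_eq_one, max_self, sub_self, zero_div, add_zero, div_one]

/-- The point of the simplex on the disjoint union of the `A j` that distributes mass `1 / |J|`
over each `A j` according to `q j`. -/
noncomputable def uniformMixture {J : Type*} [Fintype J] [Nonempty J] {A : J → Type*}
    [∀ j, Fintype (A j)] (q : ∀ j, stdSimplex ℝ (A j)) : stdSimplex ℝ (Σ j, A j) :=
  ⟨fun x => q x.1 x.2 / Fintype.card J,
    fun x => div_nonneg (stdSimplex.zero_le _ _) (Nat.cast_nonneg _), by
      have hsum j : ∑ a, q j a = 1 := stdSimplex.sum_eq_one (q j)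
      simp [Fintype.sum_sigma, ← Finset.sum_div, hsum]⟩

theorem continuous_uniformMixture {J : Type*} [Fintype J] [Nonempty J] {A : J → Type*}
    [∀ j, Fintype (A j)] :
    Continuous (uniformMixture : (∀ j, stdSimplex ℝ (A j)) → stdSimplex ℝ (Σ j, A j)) :=
  Continuous.subtype_mk (continuous_pi fun x : Σ j, A j =>
    ((continuous_stdSimplex_apply x.2).comp (continuous_apply x.1)).div_const _) _

theorem exists_pi_stdSimplex_eq_of_continuous {J : Type*} [Finite J] {A : J → Type*}
    [∀ j, Fintype (A j)] [∀ j, Nonempty (A j)]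
    {f : (∀ j, stdSimplex ℝ (A j)) → ∀ j, stdSimplex ℝ (A j)} (hf : Continuous f) :
    ∃ q, f q = q := by
  cases isEmpty_or_nonempty J with
  | inl _ => exact ⟨_, Subsingleton.elim _ (Classical.arbitrary _)⟩
  | inr _ =>
    have := Fintype.ofFinite J
    have : Nonempty (Σ j, A j) := Nonempty.map (fun j => ⟨j, Classical.arbitrary _⟩) ‹Nonempty J›
    let components (x : stdSimplex ℝ (Σ j, A j)) (j : J) : stdSimplex ℝ (A j) :=
      simplexRetraction fun a => Fintype.card J * x ⟨j, a⟩
    have hcomponents : Continuous components := continuous_pi fun j =>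
      continuous_simplexRetraction.comp <| continuous_pi fun a =>
        (continuous_stdSimplex_apply (⟨j, a⟩ : Σ j, A j)).const_mul _
    have components_uniformMixture q : components (uniformMixture q) = q := funext fun j => by
      rw [← simplexRetraction_apply_self (q j)]
      exact congrArg simplexRetraction (funext fun a => mul_div_cancel₀ _ (by positivity))
    obtain ⟨x, hx⟩ := exists_stdSimplex_eq_of_continuous
      (continuous_uniformMixture.comp (hf.comp hcomponents))
    refine ⟨components x, ?_⟩
    rw [← components_uniformMixture (f (components x))]
    exact congrArg components hx

end ProductFixedPoint

section Softmax

variable {ι : Type*} [Fintype ι] [Nonempty ι]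

/-- The Gibbs distribution with weights proportional to `exp (v a)`, that is, the logit response to
the utilities `v`. -/
noncomputable def softmax (v : ι → ℝ) : stdSimplex ℝ ι :=
  ⟨fun a => Real.exp (v a) / ∑ b, Real.exp (v b), fun a => by positivity, by
    rw [← Finset.sum_div, div_self (by positivity)]⟩

theorem softmax_apply (v : ι → ℝ) (a : ι) :
    softmax v a = Real.exp (v a) / ∑ b, Real.exp (v b) := rfl

theorem softmax_pos (v : ι → ℝ) (a : ι) : 0 < softmax v a := by
  rw [softmax_apply]
  positivity

theorem softmax_le_exp_sub (v : ι → ℝ) (a b : ι) : softmax v a ≤ Real.exp (v a - v b) := by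
  rw [softmax_apply, Real.exp_sub]
  gcongr
  exact Finset.single_le_sum (f := fun b => Real.exp (v b)) (fun _ _ => (Real.exp_pos _).le)
    (Finset.mem_univ b)

theorem continuous_softmax : Continuous (softmax : (ι → ℝ) → stdSimplex ℝ ι) := by
  refine Continuous.subtype_mk (continuous_pi fun a => Continuous.div ?_ ?_ fun v => ?_) _
  · fun_prop
  · fun_prop
  · positivity

theorem exists_eq_softmax {J : Type*} [Finite J] {A : J → Type*} [∀ j, Fintype (A j)]
    [∀ j, Nonempty (A j)] {Ψ : (∀ j, stdSimplex ℝ (A j)) → ∀ j, A j → ℝ} (hΨ : Continuous Ψ) :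
    ∃ q, ∀ j, q j = softmax (Ψ q j) := by
  obtain ⟨q, hq⟩ := exists_pi_stdSimplex_eq_of_continuous (f := fun q j => softmax (Ψ q j))
    (continuous_pi fun j => continuous_softmax.comp ((continuous_apply j).comp hΨ))
  exact ⟨q, fun j => (congrFun hq j).symm⟩

end Softmax

open MeasureTheory in
theorem measureReal_bot_top_eq_add (μ : Measure EReal) [IsFiniteMeasure μ] :
    μ.real {⊥, ⊤} = μ.real {⊥} + μ.real {⊤} := by
  rw [Set.insert_eq, measureReal_union (by simp) (measurableSet_singleton _)]

namespace Lottery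

open MeasureTheory

variable {X Y : Lottery}

theorem K_coe (a : ℝ) (X : Lottery) :
    K a X = if a = 0 then X.expect (fun x => x)
      else 1 / a * Real.log (X.expect fun x => Real.exp (a * x)) := rfl

theorem expect_mono {f g : ℝ → ℝ} (h : ∀ x ∈ X.prob.support, f x ≤ g x) :
    X.expect f ≤ X.expect g :=
  Finset.sum_le_sum fun x hx => mul_le_mul_of_nonneg_left (h x hx) (X.nonneg x)

theorem expect_const (X : Lottery) (c : ℝ) : X.expect (fun _ => c) = c := by
  rw [expect, ← Finset.sum_mul, X.total, one_mul]

theorem expect_add_const (X : Lottery) (f : ℝ → ℝ) (c : ℝ) :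
    X.expect (fun x => f x + c) = X.expect f + c := by
  conv_rhs => rw [← X.expect_const c]
  simp only [expect, mul_add, Finset.sum_add_distrib]

theorem expect_mul_const (X : Lottery) (f : ℝ → ℝ) (c : ℝ) :
    X.expect (fun x => f x * c) = X.expect f * c := by
  simp only [expect, Finset.sum_mul, mul_assoc]

theorem expect_exp_pos (X : Lottery) (a : ℝ) : 0 < X.expect fun x => Real.exp (a * x) :=
  Finset.sum_pos (fun x hx => mul_pos
    ((X.nonneg x).lt_of_ne' (Finsupp.mem_support_iff.1 hx)) (Real.exp_pos _)) X.support_nonempty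

theorem exp_mul_K {a : ℝ} (ha : a ≠ 0) (X : Lottery) :
    Real.exp (a * K a X) = X.expect fun x => Real.exp (a * x) := by
  rw [K_coe, if_neg ha, ← mul_assoc, mul_one_div_cancel ha, one_mul,
    Real.exp_log (X.expect_exp_pos a)]

theorem exp_mul_K_add {a : ℝ} (ha : a ≠ 0) (X : Lottery) (c : ℝ) :
    Real.exp (a * (K a X + c)) = X.expect fun x => Real.exp (a * (x + c)) := by
  simp only [mul_add, Real.exp_add, exp_mul_K ha, expect_mul_const]

theorem K_coe_le_K_coe_add {c : ℝ}
    (h : ∀ f : ℝ → ℝ, Monotone f → X.expect f ≤ Y.expect fun x => f (x + c)) (a : ℝ) :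
    K a X ≤ K a Y + c := by
  rcases lt_trichotomy a 0 with ha | rfl | ha
  · have hanti : Monotone fun x : ℝ => Real.exp (a * x) * (-1) := fun x y hxy => by
      have := Real.exp_le_exp.2 (mul_le_mul_of_nonpos_left hxy ha.le)
      linarith
    have hexp := h _ hanti
    rw [expect_mul_const, expect_mul_const, ← exp_mul_K ha.ne, ← exp_mul_K_add ha.ne] at hexp
    refine (mul_le_mul_left_of_neg ha).1 (Real.exp_le_exp.1 ?_)
    linarith
  · rw [K_coe, K_coe, if_pos rfl, if_pos rfl, ← expect_add_const]
    exact h _ monotone_id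
  · have hmono : Monotone fun x : ℝ => Real.exp (a * x) := fun x y hxy =>
      Real.exp_le_exp.2 (mul_le_mul_of_nonneg_left hxy ha.le)
    have hexp := h _ hmono
    rw [← exp_mul_K ha.ne', ← exp_mul_K_add ha.ne'] at hexp
    exact le_of_mul_le_mul_left (Real.exp_le_exp.1 hexp) ha

/-- The lottery that pays `c` with certainty. -/
noncomputable def dirac (c : ℝ) : Lottery where
  prob := Finsupp.single c 1
  nonneg x := by
    rw [Finsupp.single_apply]
    split_ifs <;> norm_num
  total := by
    change Finsupp.sum _ (fun _ w => w) = 1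
    simp

theorem expect_dirac (c : ℝ) (f : ℝ → ℝ) : (dirac c).expect f = f c := by
  change Finsupp.sum (Finsupp.single c 1) (fun x w => w * f x) = f c
  simp

theorem K_coe_dirac (a c : ℝ) : K a (dirac c) = c := by
  by_cases ha : a = 0
  · rw [K_coe, if_pos ha, expect_dirac]
  · rw [K_coe, if_neg ha, expect_dirac, Real.log_exp]
    field_simp

theorem K_le {M : ℝ} (h : ∀ x ∈ X.prob.support, x ≤ M) (a : EReal) : K a X ≤ M := by
  induction a with
  | bot => exact h _ (Finset.min'_mem _ _)
  | top => exact h _ (Finset.max'_mem _ _)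
  | coe a =>
    have hle := K_coe_le_K_coe_add (X := X) (Y := dirac M) (c := 0) (fun f hf => by
      rw [expect_dirac, add_zero, ← X.expect_const (f M)]
      exact expect_mono fun x hx => hf (h x hx)) a
    rwa [K_coe_dirac, add_zero] at hle

theorem le_K {m : ℝ} (h : ∀ x ∈ X.prob.support, m ≤ x) (a : EReal) : m ≤ K a X := by
  induction a with
  | bot => exact h _ (Finset.min'_mem _ _)
  | top => exact h _ (Finset.max'_mem _ _)
  | coe a =>
    have hle := K_coe_le_K_coe_add (X := dirac m) (Y := X) (c := 0) (fun f hf => by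
      rw [expect_dirac, ← X.expect_const (f m)]
      exact expect_mono fun x hx => hf (by simpa using h x hx)) a
    rwa [K_coe_dirac, add_zero] at hle

theorem K_bot_le {x : ℝ} (hx : x ∈ X.prob.support) : K ⊥ X ≤ x :=
  Finset.min'_le _ _ hx

theorem le_K_top {x : ℝ} (hx : x ∈ X.prob.support) : x ≤ K ⊤ X :=
  Finset.le_max' _ _ hx

theorem K_bot_congr (h : X.prob.support = Y.prob.support) : K ⊥ X = K ⊥ Y := by
  change X.prob.support.min' _ = Y.prob.support.min' _
  simp only [h]

theorem K_top_congr (h : X.prob.support = Y.prob.support) : K ⊤ X = K ⊤ Y := by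
  change X.prob.support.max' _ = Y.prob.support.max' _
  simp only [h]

theorem measurable_K (X : Lottery) : Measurable fun a => K a X := by
  refine EReal.measurable_of_measurable_real ?_
  simp only [K_coe]
  refine Measurable.ite (measurableSet_singleton 0) measurable_const ?_
  unfold expect
  fun_prop

theorem integrable_K (μ : Measure EReal) [IsFiniteMeasure μ] (X : Lottery) :
    Integrable (fun a => K a X) μ :=
  Integrable.of_bound (measurable_K X).aestronglyMeasurable (max |K ⊥ X| |K ⊤ X|) <|
    Filter.Eventually.of_forall fun a =>
      abs_le_max_abs_abs (le_K (fun _ => K_bot_le) a) (K_le (fun _ => le_K_top) a)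

theorem mixK_eq_mul_of_forall_eq (μ : Measure EReal) {c : ℝ} (h : ∀ x ∈ X.prob.support, x = c) :
    mixK μ X = μ.real Set.univ * c := by
  have hK a : K a X = c :=
    le_antisymm (K_le (fun x hx => (h x hx).le) a) (le_K (fun x hx => (h x hx).ge) a)
  simp [mixK, hK]

theorem mixK_eq_add_mixK_restrict (μ : Measure EReal) [IsFiniteMeasure μ] (X : Lottery) :
    mixK μ X = μ.real {⊥} * K ⊥ X + μ.real {⊤} * K ⊤ X + mixK (μ.restrict {⊥, ⊤}ᶜ) X := by
  have hX := integrable_K μ X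
  rw [mixK, mixK, ← integral_add_compl (s := {⊥, ⊤}) (by measurability) hX, Set.insert_eq,
    setIntegral_union (by simp) (measurableSet_singleton _) hX.integrableOn hX.integrableOn,
    integral_singleton, integral_singleton, smul_eq_mul, smul_eq_mul]

theorem mixK_add_le_mixK_add (μ : Measure EReal) [IsFiniteMeasure μ] {c d : ℝ}
    (hbot : K ⊥ Y + d ≤ K ⊥ X) (htop : K ⊤ Y + d ≤ K ⊤ X)
    (hreal : ∀ t : ℝ, K t Y ≤ K t X + c) :
    mixK μ Y + d * μ.real {⊥, ⊤} ≤ mixK μ X + c * μ.real {⊥, ⊤}ᶜ := by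
  have hfinite : mixK (μ.restrict {⊥, ⊤}ᶜ) Y ≤
      mixK (μ.restrict {⊥, ⊤}ᶜ) X + c * μ.real {⊥, ⊤}ᶜ := by
    have hc : ∫ _ in {⊥, ⊤}ᶜ, c ∂μ = c * μ.real {⊥, ⊤}ᶜ := by
      rw [setIntegral_const, smul_eq_mul, mul_comm]
    rw [mixK, mixK, ← hc, ← integral_add (integrable_K _ X) (integrable_const c)]
    refine setIntegral_mono_on (integrable_K _ Y)
      ((integrable_K _ X).add (integrable_const c)) (by measurability) fun t ht => ?_
    induction t with
    | bot => simp at ht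
    | top => simp at ht
    | coe t => exact hreal t
  have hbot' := mul_le_mul_of_nonneg_left hbot (measureReal_nonneg (μ := μ) (s := {⊥}))
  have htop' := mul_le_mul_of_nonneg_left htop (measureReal_nonneg (μ := μ) (s := {⊤}))
  rw [mixK_eq_add_mixK_restrict μ X, mixK_eq_add_mixK_restrict μ Y, measureReal_bot_top_eq_add]
  linarith

end Lottery

namespace Game

open MeasureTheory Lottery

variable {N : ℕ} {G : Game.{u} N}

theorem expect_lottery (p : G.Profile) (i : Fin N) (a : G.A i) (f : ℝ → ℝ) :
    (G.lottery p i a).expect f =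
      ∑ b : (∀ j, G.A j), (∏ j, p.prob j (b j)) * f (G.payoff i (Function.update b i a)) := by
  change Finsupp.sum (∑ b : (∀ j, G.A j),
    Finsupp.single (G.payoff i (Function.update b i a)) (∏ j, p.prob j (b j)))
      (fun x w => w * f x) = _
  rw [← Finsupp.sum_finsetSum_index (fun _ => zero_mul _) (fun _ _ _ => add_mul _ _ _)]
  simp

theorem prod_prob_nonneg (p : G.Profile) (b : ∀ j, G.A j) : 0 ≤ ∏ j, p.prob j (b j) :=
  Finset.prod_nonneg fun j _ => (p.mem_simplex j).1 (b j)

theorem mem_support_lottery {p : G.Profile} {i : Fin N} {a : G.A i} {x : ℝ} :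
    x ∈ (G.lottery p i a).prob.support ↔
      ∃ b : (∀ j, G.A j), (∀ j, p.prob j (b j) ≠ 0) ∧
        G.payoff i (Function.update b i a) = x := by
  have hprob : (G.lottery p i a).prob x = ∑ b : (∀ j, G.A j),
      if G.payoff i (Function.update b i a) = x then ∏ j, p.prob j (b j) else 0 := by
    simp only [lottery, Finsupp.finsetSum_apply, Finsupp.single_apply]
  have hnonneg (b : ∀ j, G.A j) :
      0 ≤ if G.payoff i (Function.update b i a) = x then ∏ j, p.prob j (b j) else 0 :=
    ite_nonneg (prod_prob_nonneg p b) le_rfl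
  rw [Finsupp.mem_support_iff, hprob, Ne, Finset.sum_eq_zero_iff_of_nonneg fun b _ => hnonneg b]
  simp [Finset.prod_ne_zero_iff, and_comm]

theorem K_lottery_le_add (p : G.Profile) {i : Fin N} {a a' : G.A i} {c : ℝ}
    (h : ∀ b, G.payoff i (Function.update b i a) ≤ G.payoff i (Function.update b i a') + c)
    (t : ℝ) : K t (G.lottery p i a) ≤ K t (G.lottery p i a') + c := by
  refine K_coe_le_K_coe_add (fun f hf => ?_) t
  rw [expect_lottery, expect_lottery]
  exact Finset.sum_le_sum fun b _ => mul_le_mul_of_nonneg_left (hf (h b)) (prod_prob_nonneg p b)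

theorem support_lottery_congr {p p' : G.Profile} (h : ∀ j b, p.prob j b = 0 ↔ p'.prob j b = 0)
    (i : Fin N) (a : G.A i) :
    (G.lottery p i a).prob.support = (G.lottery p' i a).prob.support := by
  ext x
  simp only [mem_support_lottery, ne_eq, h]

theorem mixK_lottery_eq_mul_of_forall_payoff_eq (μ : Measure EReal) {p : G.Profile} {i : Fin N}
    {a : G.A i} {c : ℝ} (h : ∀ b : (∀ j, G.A j), (∀ j, p.prob j (b j) ≠ 0) →
      G.payoff i (Function.update b i a) = c) :
    mixK μ (G.lottery p i a) = μ.real Set.univ * c := by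
  refine mixK_eq_mul_of_forall_eq μ fun x hx => ?_
  obtain ⟨b, hb, rfl⟩ := mem_support_lottery.1 hx
  exact h b hb

theorem abs_K_lottery_le (p : G.Profile) (i : Fin N) (a : G.A i) (t : EReal) :
    |K t (G.lottery p i a)| ≤ ∑ b : (∀ j, G.A j), |G.payoff i b| := by
  have hbound : ∀ x ∈ (G.lottery p i a).prob.support,
      |x| ≤ ∑ b : (∀ j, G.A j), |G.payoff i b| := fun x hx => by
    obtain ⟨b, -, rfl⟩ := mem_support_lottery.1 hx
    exact Finset.single_le_sum (f := fun b => |G.payoff i b|) (fun _ _ => abs_nonneg _)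
      (Finset.mem_univ _)
  exact abs_le.2 ⟨le_K (fun x hx => (abs_le.1 (hbound x hx)).1) t,
    K_le (fun x hx => (abs_le.1 (hbound x hx)).2) t⟩

/-- The profile given by a point of the product of the simplices of mixed strategies, which carries
the topology that profiles lack. -/
def Profile.ofStdSimplex (q : ∀ i, stdSimplex ℝ (G.A i)) : G.Profile where
  prob i := (q i).1
  mem_simplex i := (q i).2

theorem continuous_expect_lottery (i : Fin N) (a : G.A i) (f : ℝ → ℝ) :
    Continuous fun q => (G.lottery (.ofStdSimplex q) i a).expect f := by
  simp only [expect_lottery]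
  refine continuous_finsetSum _ fun b _ => Continuous.mul ?_ continuous_const
  exact continuous_finsetProd _ fun j _ =>
    (continuous_stdSimplex_apply (b j)).comp (continuous_apply j)

theorem continuous_K_coe_lottery (i : Fin N) (a : G.A i) (t : ℝ) :
    Continuous fun q => K t (G.lottery (.ofStdSimplex q) i a) := by
  simp only [K_coe]
  split_ifs
  · exact continuous_expect_lottery i a _
  · exact continuous_const.mul ((continuous_expect_lottery i a _).log fun q =>
      (expect_exp_pos _ t).ne')

theorem continuous_mixK_lottery {μ : Measure EReal} [IsFiniteMeasure μ] (hμ : μ {⊥, ⊤} = 0)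
    (i : Fin N) (a : G.A i) :
    Continuous fun q => mixK μ (G.lottery (.ofStdSimplex q) i a) := by
  refine continuous_of_dominated (fun q => (measurable_K _).aestronglyMeasurable)
    (fun q => Filter.Eventually.of_forall (abs_K_lottery_le _ i a)) (integrable_const _) ?_
  filter_upwards [measure_eq_zero_iff_ae_notMem.1 hμ] with t ht
  induction t with
  | bot => simp at ht
  | top => simp at ht
  | coe t => exact continuous_K_coe_lottery i a t

theorem isLQRE_ofStdSimplex_iff {Φ : Lottery → ℝ} {lam : ℝ} {q : ∀ i, stdSimplex ℝ (G.A i)} :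
    G.IsLQRE Φ lam (.ofStdSimplex q) ↔
      ∀ i, q i = softmax fun a => lam * Φ (G.lottery (.ofStdSimplex q) i a) :=
  forall_congr' fun _ => ⟨fun h => Subtype.ext (funext h), fun h a => congrArg (· a) h⟩

theorem exists_isLQRE_of_continuous {Φ κ Ψ : Lottery → ℝ} (hΦ : ∀ X, Φ X = κ X + Ψ X)
    (hκ : ∀ X Y : Lottery, X.prob.support = Y.prob.support → κ X = κ Y)
    (hΨ : ∀ i a, Continuous fun q => Ψ (G.lottery (.ofStdSimplex q) i a)) (lam : ℝ) :
    ∃ q, G.IsLQRE Φ lam (.ofStdSimplex q) := by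
  let p₀ : G.Profile := .ofStdSimplex fun _ => softmax 0
  obtain ⟨q, hq⟩ := exists_eq_softmax (A := G.A)
    (Ψ := fun q i a => lam * (κ (G.lottery p₀ i a) + Ψ (G.lottery (.ofStdSimplex q) i a)))
    (continuous_pi fun i => continuous_pi fun a => ((hΨ i a).const_add _).const_mul _)
  have hsupport j b : p₀.prob j b = 0 ↔ (Profile.ofStdSimplex q).prob j b = 0 := by
    refine iff_of_false (softmax_pos _ b).ne' ?_
    change q j b ≠ 0
    rw [hq j]
    exact (softmax_pos _ b).ne'
  refine ⟨q, isLQRE_ofStdSimplex_iff.2 fun i =>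
    (hq i).trans (congrArg softmax (funext fun a => ?_))⟩
  rw [hΦ, hκ _ _ (support_lottery_congr hsupport i a)]

theorem isNash_of_tendsto_of_isLQRE {Φ : Lottery → ℝ}
    (hΦ : ∀ i a, Continuous fun q => Φ (G.lottery (.ofStdSimplex q) i a))
    {α : Type*} {l : Filter α} [l.NeBot] {lam : α → ℝ} (hlam : Filter.Tendsto lam l Filter.atTop)
    {s : α → ∀ i, stdSimplex ℝ (G.A i)} (hs : ∀ n, G.IsLQRE Φ (lam n) (.ofStdSimplex (s n)))
    {q : ∀ i, stdSimplex ℝ (G.A i)} (hq : Filter.Tendsto s l (nhds q)) :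
    G.IsNash Φ (.ofStdSimplex q) := by
  intro i a ha b
  by_contra! hlt
  let gain q := Φ (G.lottery (.ofStdSimplex q) i b) - Φ (G.lottery (.ofStdSimplex q) i a)
  have hgain : Filter.Tendsto (fun n => gain (s n)) l (nhds (gain q)) :=
    (((hΦ i b).sub (hΦ i a)).tendsto q).comp hq
  have hexp : Filter.Tendsto (fun n => Real.exp (-(lam n * gain (s n)))) l (nhds 0) :=
    Real.tendsto_exp_neg_atTop_nhds_zero.comp (hlam.atTop_mul_pos (sub_pos.2 hlt) hgain)
  have hprob : Filter.Tendsto (fun n => s n i a) l (nhds (q i a)) :=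
    ((continuous_stdSimplex_apply a).tendsto (q i)).comp (tendsto_pi_nhds.1 hq i)
  have hle n : s n i a ≤ Real.exp (-(lam n * gain (s n))) := by
    rw [isLQRE_ofStdSimplex_iff.1 (hs n) i]
    refine (softmax_le_exp_sub _ a b).trans_eq (congrArg Real.exp ?_)
    ring
  exact ha (le_antisymm (le_of_tendsto_of_tendsto' hprob hexp hle) (stdSimplex.zero_le (q i) a))

theorem exists_isNash_of_continuous {Φ : Lottery → ℝ}
    (hΦ : ∀ i a, Continuous fun q => Φ (G.lottery (.ofStdSimplex q) i a)) :
    ∃ p, G.IsNash Φ p := by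
  choose s hs using fun n : ℕ => G.exists_isLQRE_of_continuous (κ := 0)
    (fun X => (zero_add (Φ X)).symm) (fun _ _ _ => rfl) hΦ n
  obtain ⟨q, φ, hφ, hlim⟩ := CompactSpace.tendsto_subseq s
  exact ⟨_, isNash_of_tendsto_of_isLQRE hΦ
    (tendsto_natCast_atTop_atTop.comp hφ.tendsto_atTop) (fun n => hs (φ n)) hlim⟩

theorem exists_isLQRE_mixK (G : Game.{u} N) (μ : Measure EReal) [IsFiniteMeasure μ] (lam : ℝ) :
    ∃ p, G.IsLQRE (mixK μ) lam p := by
  obtain ⟨q, hq⟩ := G.exists_isLQRE_of_continuous (mixK_eq_add_mixK_restrict μ)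
    (fun X Y h => by rw [K_bot_congr h, K_top_congr h])
    (continuous_mixK_lottery (by simp [Measure.restrict_apply])) lam
  exact ⟨_, hq⟩

theorem Profile.exists_prob_ne_zero (p : G.Profile) (i : Fin N) : ∃ a, p.prob i a ≠ 0 := by
  by_contra! h
  simpa [h] using (p.mem_simplex i).2

theorem Profile.exists_apply_eq_and_forall_prob_ne_zero (p : G.Profile) {i : Fin N} {a : G.A i}
    (ha : p.prob i a ≠ 0) : ∃ b : (∀ j, G.A j), b i = a ∧ ∀ j, p.prob j (b j) ≠ 0 := by
  choose b hb using p.exists_prob_ne_zero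
  refine ⟨Function.update b i a, Function.update_self .., fun j => ?_⟩
  rcases eq_or_ne j i with rfl | hj
  · rwa [Function.update_self]
  · rw [Function.update_of_ne hj]
    exact hb j

theorem IsNash.prob_eq_zero_of_lt {Φ : Lottery → ℝ} {p : G.Profile} (hp : G.IsNash Φ p)
    {i : Fin N} {a b : G.A i} (h : Φ (G.lottery p i a) < Φ (G.lottery p i b)) :
    p.prob i a = 0 := by
  by_contra ha
  exact (hp i a ha b).not_gt h

section ModifiedPennies

/-- The first of the two players of `modifiedPennies` who have a choice; they choose a row. -/
def rowPlayer (hN : 2 ≤ N) : Fin N := ⟨0, by omega⟩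

/-- The second of the two players of `modifiedPennies` who have a choice; they choose a column. -/
def colPlayer (hN : 2 ≤ N) : Fin N := ⟨1, by omega⟩

variable {hN : 2 ≤ N} {ε : ℝ}

/-- The two actions of the first player in `modifiedPennies`. -/
def row (k : Fin 2) : (modifiedPennies.{u} N hN ε).A (rowPlayer hN) := ULift.up k

/-- The two actions of the second player in `modifiedPennies`. -/
def col (l : Fin 2) : (modifiedPennies.{u} N hN ε).A (colPlayer hN) := ULift.up l

theorem row_surjective :
    Function.Surjective (row : Fin 2 → (modifiedPennies.{u} N hN ε).A (rowPlayer hN)) :=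
  fun a => ⟨a.down, rfl⟩

theorem col_surjective :
    Function.Surjective (col : Fin 2 → (modifiedPennies.{u} N hN ε).A (colPlayer hN)) :=
  fun a => ⟨a.down, rfl⟩

theorem payoff_rowPlayer {b : ∀ j, (modifiedPennies.{u} N hN ε).A j} {k l : Fin 2}
    (hrow : b (rowPlayer hN) = row k) (hcol : b (colPlayer hN) = col l) :
    (modifiedPennies N hN ε).payoff (rowPlayer hN) b =
      !![1 + 1 / ε, 0; -(1 / ε), 1] k l := by
  change (if (b (rowPlayer hN)).down.val = 0 then
    if (b (colPlayer hN)).down.val = 0 then 1 + 1 / ε else 0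
    else if (b (colPlayer hN)).down.val = 0 then -(1 / ε) else 1) = _
  rw [hrow, hcol]
  fin_cases k <;> fin_cases l <;> rfl

theorem payoff_colPlayer {b : ∀ j, (modifiedPennies.{u} N hN ε).A j} {k l : Fin 2}
    (hrow : b (rowPlayer hN) = row k) (hcol : b (colPlayer hN) = col l) :
    (modifiedPennies N hN ε).payoff (colPlayer hN) b = !![0, 1; 1, 0] k l := by
  change (if (b (rowPlayer hN)).down.val = (b (colPlayer hN)).down.val then 0 else 1) = _
  rw [hrow, hcol]
  fin_cases k <;> fin_cases l <;> rfl

theorem payoff_update_row {b : ∀ j, (modifiedPennies.{u} N hN ε).A j} {l : Fin 2}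
    (hcol : b (colPlayer hN) = col l) (k : Fin 2) :
    (modifiedPennies N hN ε).payoff (rowPlayer hN) (Function.update b (rowPlayer hN) (row k)) =
      !![1 + 1 / ε, 0; -(1 / ε), 1] k l :=
  payoff_rowPlayer (Function.update_self ..) <|
    (Function.update_of_ne (by simp [rowPlayer, colPlayer]) _ _).trans hcol

theorem payoff_update_col {b : ∀ j, (modifiedPennies.{u} N hN ε).A j} {k : Fin 2}
    (hrow : b (rowPlayer hN) = row k) (l : Fin 2) :
    (modifiedPennies N hN ε).payoff (colPlayer hN) (Function.update b (colPlayer hN) (col l)) =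
      !![0, 1; 1, 0] k l :=
  payoff_colPlayer ((Function.update_of_ne (by simp [rowPlayer, colPlayer]) _ _).trans hrow) <|
    Function.update_self ..

variable {p : (modifiedPennies.{u} N hN ε).Profile}

theorem mixK_lottery_row_of_prob_col_zero_eq_zero (μ : Measure EReal)
    (hp : p.prob (colPlayer hN) (col 0) = 0) (k : Fin 2) :
    mixK μ ((modifiedPennies N hN ε).lottery p (rowPlayer hN) (row k)) =
      μ.real Set.univ * ![0, 1] k := by
  refine mixK_lottery_eq_mul_of_forall_payoff_eq μ fun b hb => ?_
  obtain ⟨l, hl⟩ := col_surjective (b (colPlayer hN))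
  rw [payoff_update_row hl.symm]
  have hl₁ : l ≠ 0 := by
    rintro rfl
    exact hb (colPlayer hN) (hl ▸ hp)
  fin_cases l
  · exact absurd rfl hl₁
  · fin_cases k <;> rfl

theorem mixK_lottery_col_of_prob_row_eq_zero (μ : Measure EReal) {k : Fin 2}
    (hp : p.prob (rowPlayer hN) (row k) = 0) (l : Fin 2) :
    mixK μ ((modifiedPennies N hN ε).lottery p (colPlayer hN) (col l)) =
      μ.real Set.univ * if k = l then 1 else 0 := by
  refine mixK_lottery_eq_mul_of_forall_payoff_eq μ fun b hb => ?_
  obtain ⟨k', hk'⟩ := row_surjective (b (rowPlayer hN))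
  have hne : k' ≠ k := by
    rintro rfl
    exact hb (rowPlayer hN) (hk' ▸ hp)
  rw [payoff_update_col hk'.symm]
  fin_cases k <;> fin_cases k' <;> fin_cases l <;> simp at hne ⊢

theorem mem_support_lottery_row (hp : p.prob (colPlayer hN) (col 0) ≠ 0) (k : Fin 2) :
    !![1 + 1 / ε, 0; -(1 / ε), 1] k 0 ∈
      ((modifiedPennies N hN ε).lottery p (rowPlayer hN) (row k)).prob.support := by
  obtain ⟨b, hcol, hb⟩ := p.exists_apply_eq_and_forall_prob_ne_zero hp
  exact mem_support_lottery.2 ⟨b, hb, payoff_update_row hcol k⟩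

theorem exists_eq_of_mem_support_lottery_row {k : Fin 2} {x : ℝ}
    (hx : x ∈ ((modifiedPennies N hN ε).lottery p (rowPlayer hN) (row k)).prob.support) :
    ∃ l, x = !![1 + 1 / ε, 0; -(1 / ε), 1] k l := by
  obtain ⟨b, -, rfl⟩ := mem_support_lottery.1 hx
  obtain ⟨l, hl⟩ := col_surjective (b (colPlayer hN))
  exact ⟨l, payoff_update_row hl.symm k⟩

theorem mixK_lottery_row_one_lt_row_zero {μ : Measure EReal} [IsFiniteMeasure μ] (hε : 0 < ε)
    (hμ : ε * μ.real {⊥, ⊤}ᶜ < μ.real {⊥, ⊤}) (hp : p.prob (colPlayer hN) (col 0) ≠ 0) :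
    mixK μ ((modifiedPennies N hN ε).lottery p (rowPlayer hN) (row 1)) <
      mixK μ ((modifiedPennies N hN ε).lottery p (rowPlayer hN) (row 0)) := by
  let X (k : Fin 2) := (modifiedPennies N hN ε).lottery p (rowPlayer hN) (row k)
  change mixK μ (X 1) < mixK μ (X 0)
  have hinv : 0 < 1 / ε := one_div_pos.2 hε
  have hmin₁ : K ⊥ (X 1) ≤ -(1 / ε) := K_bot_le (mem_support_lottery_row hp 1)
  have hmin₀ : 0 ≤ K ⊥ (X 0) := by
    refine le_K (fun x hx => ?_) ⊥
    obtain ⟨l, rfl⟩ := exists_eq_of_mem_support_lottery_row hx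
    fin_cases l
    exacts [add_nonneg zero_le_one hinv.le, le_rfl]
  have hmax₁ : K ⊤ (X 1) ≤ 1 := by
    refine K_le (fun x hx => ?_) ⊤
    obtain ⟨l, rfl⟩ := exists_eq_of_mem_support_lottery_row hx
    fin_cases l
    exacts [(neg_nonpos.2 hinv.le).trans zero_le_one, le_rfl]
  have hmax₀ : 1 + 1 / ε ≤ K ⊤ (X 0) := le_K_top (mem_support_lottery_row hp 0)
  have hreal (t : ℝ) : K t (X 1) ≤ K t (X 0) + 1 := by
    refine K_lottery_le_add p (fun b => ?_) t
    obtain ⟨l, hl⟩ := col_surjective (b (colPlayer hN))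
    rw [payoff_update_row hl.symm, payoff_update_row hl.symm]
    fin_cases l
    · change -(1 / ε) ≤ 1 + 1 / ε + 1
      linarith
    · exact (zero_add 1).ge
  have hgain : mixK μ (X 1) + 1 / ε * μ.real {⊥, ⊤} ≤ mixK μ (X 0) + 1 * μ.real {⊥, ⊤}ᶜ :=
    mixK_add_le_mixK_add μ (by linarith) (by linarith) hreal
  have hmass : μ.real {⊥, ⊤}ᶜ < 1 / ε * μ.real {⊥, ⊤} := by
    rwa [one_div, lt_inv_mul_iff₀ hε]
  linarith

theorem not_isNash_modifiedPennies {μ : Measure EReal} [IsFiniteMeasure μ] (hε : 0 < ε)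
    (hμ : ε * μ.real {⊥, ⊤}ᶜ < μ.real {⊥, ⊤}) (p : (modifiedPennies.{u} N hN ε).Profile) :
    ¬ (modifiedPennies.{u} N hN ε).IsNash (mixK μ) p := by
  intro hp
  have hpos : 0 < μ.real Set.univ :=
    ((mul_nonneg hε.le measureReal_nonneg).trans_lt hμ).trans_le
      (measureReal_mono (Set.subset_univ _))
  have hcol₀ : p.prob (colPlayer hN) (col 0) = 0 := by
    by_contra h
    have hrow₁ := hp.prob_eq_zero_of_lt (mixK_lottery_row_one_lt_row_zero hε hμ h)
    refine h (hp.prob_eq_zero_of_lt (b := col 1) ?_)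
    simp [mixK_lottery_col_of_prob_row_eq_zero μ hrow₁, hpos]
  have hrow₀ : p.prob (rowPlayer hN) (row 0) = 0 := by
    refine hp.prob_eq_zero_of_lt (b := row 1) ?_
    simp [mixK_lottery_row_of_prob_col_zero_eq_zero μ hcol₀, hpos]
  have hcol₁ : p.prob (colPlayer hN) (col 1) = 0 := by
    refine hp.prob_eq_zero_of_lt (b := col 0) ?_
    simp [mixK_lottery_col_of_prob_row_eq_zero μ hrow₀, hpos]
  obtain ⟨a, ha⟩ := p.exists_prob_ne_zero (colPlayer hN)
  obtain ⟨l, rfl⟩ := col_surjective a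
  fin_cases l
  · exact ha hcol₀
  · exact ha hcol₁

end ModifiedPennies

end Game

theorem mainTheorem5_general (N : ℕ) (hN : 2 ≤ N) (μ : MeasureTheory.Measure EReal)
    [MeasureTheory.IsFiniteMeasure μ] :
    (∀ (G : Game.{u} N) (lam : ℝ), ∃ p : G.Profile, G.IsLQRE (Lottery.mixK μ) lam p) ∧
    ((∀ G : Game.{u} N, ∃ p : G.Profile, G.IsNash (Lottery.mixK μ) p) ↔
      μ {⊥} = 0 ∧ μ {⊤} = 0) ∧
    (∀ ε : ℝ, 0 < ε → ε * μ.real {⊥, ⊤}ᶜ < μ.real {⊥, ⊤} →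
      ¬ ∃ p : (Game.modifiedPennies.{u} N hN ε).Profile,
        (Game.modifiedPennies.{u} N hN ε).IsNash (Lottery.mixK μ) p) := by
  have hnash (ε : ℝ) (hε : 0 < ε) (hμ : ε * μ.real {⊥, ⊤}ᶜ < μ.real {⊥, ⊤}) :
      ¬ ∃ p, (Game.modifiedPennies.{u} N hN ε).IsNash (Lottery.mixK μ) p :=
    fun ⟨p, hp⟩ => Game.not_isNash_modifiedPennies hε hμ p hp
  have hnull : μ {⊥, ⊤} = 0 ↔ μ {⊥} = 0 ∧ μ {⊤} = 0 := by
    rw [Set.insert_eq, MeasureTheory.measure_union_null_iff]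
  refine ⟨fun G lam => G.exists_isLQRE_mixK μ lam, ⟨fun h => hnull.1 ?_, fun h G =>
    Game.exists_isNash_of_continuous (Game.continuous_mixK_lottery (hnull.2 h))⟩, hnash⟩
  by_contra hμ
  have hpos : 0 < μ.real {⊥, ⊤} := ENNReal.toReal_pos hμ (MeasureTheory.measure_ne_top μ _)
  refine hnash (μ.real {⊥, ⊤} / (μ.real {⊥, ⊤}ᶜ + 1)) (by positivity) ?_ (h _)
  rw [div_mul_eq_mul_div, div_lt_iff₀ (by positivity)]
  linarith

theorem mainTheorem5 (N : ℕ) (hN : 2 ≤ N) (μ : MeasureTheory.Measure EReal)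
    [MeasureTheory.IsProbabilityMeasure μ] :
    (∀ (G : Game.{u} N) (lam : ℝ), 0 ≤ lam →
      ∃ p : G.Profile, G.IsLQRE (Lottery.mixK μ) lam p) ∧
    ((∀ G : Game.{u} N, ∃ p : G.Profile, G.IsNash (Lottery.mixK μ) p) ↔
      μ {⊥} = 0 ∧ μ {⊤} = 0) ∧
    (∀ ε : ℝ, ε = μ.real {⊥} + μ.real {⊤} → 0 < ε →
      ¬ ∃ p : (Game.modifiedPennies.{u} N hN ε).Profile,
        (Game.modifiedPennies.{u} N hN ε).IsNash (Lottery.mixK μ) p) := by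
  obtain ⟨hlqre, hnash, hpennies⟩ := mainTheorem5_general N hN μ
  refine ⟨fun G lam _ => hlqre G lam, hnash, fun ε hε hpos => hpennies ε hpos ?_⟩
  rw [MeasureTheory.probReal_compl_eq_one_sub (by measurability), measureReal_bot_top_eq_add, ← hε]
  nlinarith
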